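/- Let $F\in\mathbb C[x,y,z]$ be an irreducible homogeneous polynomial of degree $d\ge 2$, and let $\mathcal C=V(F)\subset\mathbb P^2=\mathbb P^2(\mathbb C)$. For $S=[x_0:y_0:z_0]\in\mathbb P^2$ put $\Delta_SF=x_0F_x+y_0F_y+z_0F_z$, and let the reflected map $R_{\mathcal C,S}:\mathbb P^2\dashrightarrow\mathbb P^2$ be the rational map $[x:y:z]\mapsto[u:v:w]$ given by the forms of degree $2d-1$ $$u=(z_0y-zy_0)(F_x^2+F_y^2)+2z\,\Delta_SF\,F_y,$$ $$v=(zx_0-z_0x)(F_x^2+F_y^2)-2z\,\Delta_SF\,F_x,$$ $$w=(xy_0-yx_0)(F_x^2+F_y^2)-2\,\Delta_SF\,(xF_y-yF_x).$$ (For a general point $m=[x:y:z]$ of $\mathcal C$, $[u:v:w]$ are the coordinates of the line obtained by reflecting the line $(mS)$ on $\mathcal C$ at $m$.) Let $T_{\mathcal C,S}:\mathcal C\dashrightarrow\mathbb P^2$ be its restriction to $\mathcal C$. Then, for a generic $S\in\mathbb P^2$, the map $T_{\mathcal C,S}$ is birational onto its image. That is, there is a nonempty Zariski open set $U\subseteq\mathbb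 P^2$ such that for every $S\in U$ the rational map $T_{\mathcal C,S}$ restricts to an isomorphism from a nonempty Zariski open subset of $\mathcal C$ onto a nonempty Zariski open subset of the Zariski closure $\overline{T_{\mathcal C,S}(\mathcal C)}$ (with inverse given by homogeneous polynomials of one common degree). -/

import Mathlib

open MvPolynomial

/-- The complex projective plane `ℙ²`. -/
abbrev ProjPlane : Type := Projectivization ℂ (Fin 3 → ℂ)

/-- A point of `ℙ²` lies on `V(f)`. For homogeneous `f` (the only case used) this does not depend
on the chosen representative of the point. -/
def VanishesAt (f : MvPolynomial (Fin 3) ℂ) (p : ProjPlane) : Prop :=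
  eval p.rep f = 0

/-- The plane curve `V(F) ⊆ ℙ²`. -/
def planeCurve (F : MvPolynomial (Fin 3) ℂ) : Set ProjPlane :=
  {p | VanishesAt F p}

/-- Zariski closed subsets of `ℙ²`: common zero loci of families of homogeneous polynomials. -/
def IsZariskiClosed (Z : Set ProjPlane) : Prop :=
  ∃ A : Set (MvPolynomial (Fin 3) ℂ),
    (∀ f ∈ A, ∃ n : ℕ, f.IsHomogeneous n) ∧ Z = {p | ∀ f ∈ A, VanishesAt f p}

/-- Zariski open subsets of `ℙ²`. -/
def IsZariskiOpen (U : Set ProjPlane) : Prop :=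
  IsZariskiClosed Uᶜ

/-- The Zariski closure of a subset of `ℙ²`. -/
def zariskiClosure (A : Set ProjPlane) : Set ProjPlane :=
  ⋂₀ {Z | IsZariskiClosed Z ∧ A ⊆ Z}

/-- `U` is a nonempty subset of `X` that is open in the Zariski topology of `X`. -/
def IsNonemptyOpenIn (U X : Set ProjPlane) : Prop :=
  U.Nonempty ∧ ∃ O : Set ProjPlane, IsZariskiOpen O ∧ U = X ∩ O

/-- Three homogeneous polynomials of the same degree, representing the rational map
`ℙ² ⇢ ℙ²`, `m ↦ [φ₀(m) : φ₁(m) : φ₂(m)]`, defined away from the common zeros. -/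
structure ProjRatMap where
  degree : ℕ
  forms : Fin 3 → MvPolynomial (Fin 3) ℂ
  homogeneous : ∀ i, (forms i).IsHomogeneous degree

/-- The value of the three forms at a vector of coordinates. -/
noncomputable def ProjRatMap.evalVec (φ : ProjRatMap) (v : Fin 3 → ℂ) : Fin 3 → ℂ :=
  fun i => eval v (φ.forms i)

/-- `φ` is defined at `p` (which is not a base point) and takes the value `q` there. -/
def ProjRatMap.HasValue (φ : ProjRatMap) (p q : ProjPlane) : Prop :=
  ∃ h : φ.evalVec p.rep ≠ 0, Projectivization.mk ℂ (φ.evalVec p.rep) h = q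

/-- The closure `Y` of the image of the restriction `φ|_X`. -/
def ProjRatMap.imageClosure (φ : ProjRatMap) (X : Set ProjPlane) : Set ProjPlane :=
  zariskiClosure {q | ∃ p ∈ X, φ.HasValue p q}

/-- The restriction of `φ` to the (irreducible) algebraic set `X` is birational onto its image:
with `Y` the Zariski closure of `φ(X)`, there are a rational map `ψ` and nonempty Zariski open
subsets `U` of `X` and `V` of `Y` such that `φ : U → V` and `ψ : V → U` are everywhere defined
and inverse to each other. -/
def ProjRatMap.IsBirationalOntoImageOn (φ : ProjRatMap) (X : Set ProjPlane) : Prop :=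
  ∃ (ψ : ProjRatMap) (U V : Set ProjPlane),
    IsNonemptyOpenIn U X ∧ IsNonemptyOpenIn V (φ.imageClosure X) ∧
    (∀ p ∈ U, ∃ q ∈ V, φ.HasValue p q ∧ ψ.HasValue q p) ∧
    (∀ q ∈ V, ∃ p ∈ U, ψ.HasValue q p ∧ φ.HasValue p q)

/-- `Δ_P F = x₁ F_x + y₁ F_y + z₁ F_z`, for `P = (x₁, y₁, z₁)`. -/
noncomputable def polarForm (F : MvPolynomial (Fin 3) ℂ) (P : Fin 3 → ℂ) :
    MvPolynomial (Fin 3) ℂ :=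
  C (P 0) * pderiv 0 F + C (P 1) * pderiv 1 F + C (P 2) * pderiv 2 F

/-- `Q(∇F) = F_x² + F_y²`. -/
noncomputable def gradQ (F : MvPolynomial (Fin 3) ℂ) : MvPolynomial (Fin 3) ℂ :=
  pderiv 0 F ^ 2 + pderiv 1 F ^ 2

/-- The coordinates `u, v, w` of the line obtained by reflecting on `V(F)`, at the point
`[x : y : z]`, the line that joins this point to the source `[x₀ : y₀ : z₀] = [s 0 : s 1 : s 2]`. -/
noncomputable def reflectedForms (F : MvPolynomial (Fin 3) ℂ) (s : Fin 3 → ℂ) :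
    Fin 3 → MvPolynomial (Fin 3) ℂ :=
  ![(C (s 2) * X 1 - X 2 * C (s 1)) * gradQ F + 2 * X 2 * polarForm F s * pderiv 1 F,
    (X 2 * C (s 0) - C (s 2) * X 0) * gradQ F - 2 * X 2 * polarForm F s * pderiv 0 F,
    (X 0 * C (s 1) - X 1 * C (s 0)) * gradQ F
      - 2 * polarForm F s * (X 0 * pderiv 1 F - X 1 * pderiv 0 F)]

theorem reflectedForms_isHomogeneous {F : MvPolynomial (Fin 3) ℂ} {d : ℕ}
    (hF : F.IsHomogeneous d) (s : Fin 3 → ℂ) (i : Fin 3) :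
    (reflectedForms F s i).IsHomogeneous (1 + 2 * (d - 1)) := by
  have hD : ∀ j : Fin 3, (pderiv j F).IsHomogeneous (d - 1) := fun j => hF.pderiv
  have hX : ∀ j : Fin 3, (X j : MvPolynomial (Fin 3) ℂ).IsHomogeneous 1 :=
    fun j => isHomogeneous_X ℂ j
  have hCX : ∀ (a : ℂ) (j : Fin 3), (C a * X j : MvPolynomial (Fin 3) ℂ).IsHomogeneous 1 :=
    fun a j => (hX j).C_mul a
  have hQ : (gradQ F).IsHomogeneous (2 * (d - 1)) := by
    have h : ∀ j : Fin 3, (pderiv j F ^ 2).IsHomogeneous (2 * (d - 1)) := fun j => by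
      simpa [mul_comm] using (hD j).pow 2
    exact (h 0).add (h 1)
  have hP : (polarForm F s).IsHomogeneous (d - 1) :=
    (((hD 0).C_mul _).add ((hD 1).C_mul _)).add ((hD 2).C_mul _)
  have h2 : ∀ {p : MvPolynomial (Fin 3) ℂ} {n : ℕ}, p.IsHomogeneous n →
      (2 * p).IsHomogeneous n := fun {p n} h => by
    simpa [two_mul] using h.add h
  have e : 1 + (d - 1) + (d - 1) = 1 + 2 * (d - 1) := by ring
  have e' : (d - 1) + (1 + (d - 1)) = 1 + 2 * (d - 1) := by ring
  have hR : ∀ j : Fin 3,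
      (2 * X 2 * polarForm F s * pderiv j F).IsHomogeneous (1 + 2 * (d - 1)) := fun j => by
    rw [← e]
    exact ((h2 (hX 2)).mul hP).mul (hD j)
  fin_cases i
  · refine IsHomogeneous.add (IsHomogeneous.mul ?_ hQ) (hR 1)
    rw [mul_comm (X 2)]
    exact (hCX _ _).sub (hCX _ _)
  · refine IsHomogeneous.sub (IsHomogeneous.mul ?_ hQ) (hR 0)
    rw [mul_comm (X 2)]
    exact (hCX _ _).sub (hCX _ _)
  · refine IsHomogeneous.sub (IsHomogeneous.mul ?_ hQ) ?_
    · rw [mul_comm (X 0), mul_comm (X 1)]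
      exact (hCX _ _).sub (hCX _ _)
    · rw [← e']
      exact (h2 hP).mul (((hX 0).mul (hD 1)).sub ((hX 1).mul (hD 0)))

/-- The reflected map `R_{C,S} : ℙ² ⇢ ℙ²` of the curve `C = V(F)` from the source `S`. Another
representative of `S` multiplies the three forms by a common nonzero scalar. -/
noncomputable def reflectedMap {F : MvPolynomial (Fin 3) ℂ} {d : ℕ} (hF : F.IsHomogeneous d)
    (S : ProjPlane) : ProjRatMap where
  degree := 1 + 2 * (d - 1)
  forms := reflectedForms F S.rep
  homogeneous := reflectedForms_isHomogeneous hF S.rep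

/-!
The reflected line at a point `m` of the curve `V(F)` is the line joining `m` to the mirror image of
the source `S` in the tangent at `m`; its coordinates are `reflVec m g S`, where `g` is the gradient
of `F` at `m`. Reflection at `m` is an involution on the lines through `m`.

Let the source be generic: `S = a` with coordinates algebraically independent over a field `K` that
contains the coordinates of the generic point `m` of the curve. If `m` were not a rational function
of `a` and of the reflected line, some field embedding would fix `a` and this line, and move `m` to
another point `m'` of the curve with the same reflected line. This line is then `mm'`, so `a` lies on
both reflections of the line `mm'`, at `m` and at `m'`. If the two reflections are distinct, then `a`
is determined, up to a scalar, by `m` and `m'`; but `m'` moves on a curve, so that the transcendence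
degree of the coordinates of `a` over `K` would be at most two instead of three. If they coincide,
both are the line `mm'`, which is then its own reflection at `m`; so it is the tangent or the normal
at `m`, and a generic point `a` does not lie on these lines (`tangent_or_normal_or_eq_smul_cross`,
`div_mem_adjoin_reflVec`). The argument requires that the tangent at the generic point is not
isotropic, that is, that `F` does not divide `F_x ^ 2 + F_y ^ 2` (`not_dvd_gradQ`).

So the point of incidence is given by polynomials in the coordinates of the source and of the
reflected line. By the Nullstellensatz, their denominators do not vanish identically on the curve for
a general source (`exists_polynomial_inverse`). Their homogeneous components in a suitable degree
still give an inverse, and this inverse is defined and takes values in the curve on a nonempty open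
subset of the closure of the image (`ProjRatMap.isBirationalOntoImageOn_of_polynomial_leftInverse`).
-/

open scoped Matrix

/-! ### Reflected lines in coordinates -/

/-- The coordinates of the line obtained by reflecting the line `mS` at `m` on a curve whose
gradient at `m` is `g`. With the normal direction `n = (g 0, g 1, 0)`, they are those of the line
joining `m` to the mirror image `(g 0 ^ 2 + g 1 ^ 2) S - 2 (g ⬝ᵥ S) n` of `S` in the tangent. -/
def reflVec {R : Type*} [CommRing R] (m g S : Fin 3 → R) : Fin 3 → R :=
  ![(S 2 * m 1 - m 2 * S 1) * (g 0 ^ 2 + g 1 ^ 2)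
      + 2 * m 2 * (S 0 * g 0 + S 1 * g 1 + S 2 * g 2) * g 1,
    (m 2 * S 0 - S 2 * m 0) * (g 0 ^ 2 + g 1 ^ 2)
      - 2 * m 2 * (S 0 * g 0 + S 1 * g 1 + S 2 * g 2) * g 0,
    (m 0 * S 1 - m 1 * S 0) * (g 0 ^ 2 + g 1 ^ 2)
      - 2 * (S 0 * g 0 + S 1 * g 1 + S 2 * g 2) * (m 0 * g 1 - m 1 * g 0)]

theorem map_reflVec {R R' : Type*} [CommRing R] [CommRing R'] (f : R →+* R')
    (m g S : Fin 3 → R) (j : Fin 3) :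
    f (reflVec m g S j) = reflVec (f ∘ m) (f ∘ g) (f ∘ S) j := by
  fin_cases j <;> simp [reflVec, map_ofNat]

theorem reflVec_smul_source {R : Type*} [CommRing R] (t : R) (m g S : Fin 3 → R) :
    reflVec m g (t • S) = t • reflVec m g S := by
  ext j; fin_cases j <;> simp [reflVec] <;> ring

theorem reflVec_smul_point {R : Type*} [CommRing R] (t u : R) (m g S : Fin 3 → R) :
    reflVec (t • m) (u • g) S = (t * u ^ 2) • reflVec m g S := by
  ext j; fin_cases j <;> simp [reflVec] <;> ring

theorem reflVec_dotProduct_self {R : Type*} [CommRing R] (m g S : Fin 3 → R) :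
    reflVec m g S ⬝ᵥ m = 0 := by
  simp [reflVec, dotProduct, Fin.sum_univ_three]; ring

/-- Reflection is an involution on lines through `m`: the reflected line of `mS` passes through
`P` if and only if the reflected line of `mP` passes through `S`. -/
theorem reflVec_dotProduct_comm {R : Type*} [CommRing R] {m g : Fin 3 → R} (hm : g ⬝ᵥ m = 0)
    (P S : Fin 3 → R) : reflVec m g P ⬝ᵥ S = reflVec m g S ⬝ᵥ P := by
  simp only [dotProduct, Fin.sum_univ_three] at hm
  simp [reflVec, dotProduct, Fin.sum_univ_three]
  -- the factor is the determinant of the normal direction, `S` and `P`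
  linear_combination -2 * (g 0 * (S 1 * P 2 - S 2 * P 1) - g 1 * (S 0 * P 2 - S 2 * P 0)) * hm

/-- The determinant of `m`, the normal direction `(g 0, g 1, 0)` and `S`: it vanishes when `S`
lies on the normal at `m`. -/
def normalForm {R : Type*} [CommRing R] (m g S : Fin 3 → R) : R :=
  -(m 2 * g 1) * S 0 + m 2 * g 0 * S 1 + (m 0 * g 1 - m 1 * g 0) * S 2

theorem exists_smul_of_cross_eq_zero {k : Type*} [Field k] {u v : Fin 3 → k} (hu : u ≠ 0)
    (h : u ⨯₃ v = 0) : ∃ c : k, v = c • u := by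
  obtain ⟨i, hi⟩ := Function.ne_iff.1 hu
  replace hi : u i ≠ 0 := hi
  have h0 : u 1 * v 2 - u 2 * v 1 = 0 := by simpa [cross_apply] using congrFun h 0
  have h1 : u 2 * v 0 - u 0 * v 2 = 0 := by simpa [cross_apply] using congrFun h 1
  have h2 : u 0 * v 1 - u 1 * v 0 = 0 := by simpa [cross_apply] using congrFun h 2
  refine ⟨v i / u i, ?_⟩
  ext j
  rw [Pi.smul_apply, smul_eq_mul, div_mul_eq_mul_div, eq_div_iff hi]
  fin_cases i <;> fin_cases j <;> simp only [Fin.zero_eta, Fin.mk_one, Fin.reduceFinMk] <;>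
    first | linear_combination h0 | linear_combination h1 | linear_combination h2 |
      linear_combination -h0 | linear_combination -h1 | linear_combination -h2

/-- If the tangent at `m` is not isotropic and `P` is another point than `m`, then the reflected
line of `mP` is a line: reflection at `m` is invertible. -/
theorem reflVec_ne_zero {k : Type*} [Field k] {m g P : Fin 3 → k}
    (hm : g ⬝ᵥ m = 0) (hQ : g 0 ^ 2 + g 1 ^ 2 ≠ 0) (hP : m ⨯₃ P ≠ 0) : reflVec m g P ≠ 0 := by
  intro h
  have hm0 : m ≠ 0 := by rintro rfl; simp at hP
  -- `w` is the reflection of `P`, so that `reflVec m g P = m ⨯₃ w`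
  set w : Fin 3 → k :=
    fun i => (g 0 ^ 2 + g 1 ^ 2) * P i - 2 * (g ⬝ᵥ P) * (![g 0, g 1, 0] i) with hw
  have hmw : m ⨯₃ w = 0 := by
    rw [← h]
    ext j
    fin_cases j <;> simp [hw, cross_apply, reflVec, dotProduct, Fin.sum_univ_three] <;> ring
  obtain ⟨c, hc⟩ := exists_smul_of_cross_eq_zero hm0 hmw
  have h1 : g ⬝ᵥ w = 0 := by rw [hc, dotProduct_smul, hm, smul_zero]
  have h3 : g ⬝ᵥ w = -((g 0 ^ 2 + g 1 ^ 2) * (g ⬝ᵥ P)) := by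
    simp [hw, dotProduct, Fin.sum_univ_three]; ring
  have h4 : g ⬝ᵥ P = 0 := by
    rw [h1] at h3
    exact (mul_eq_zero.1 (neg_eq_zero.1 h3.symm)).resolve_left hQ
  have h5 : w = (g 0 ^ 2 + g 1 ^ 2) • P := by
    ext i
    simp [hw, h4]
  rw [h5] at hmw
  simp [hQ, hP] at hmw

/-- If the line `mm'` is the reflection of `mS` at `m` and of `m'S` at `m'`, then `S` lies on the
tangent at `m`, or on the normal at `m`, or it is the intersection of the reflections of the line
`mm'` at `m` and at `m'`. -/
theorem tangent_or_normal_or_eq_smul_cross {k : Type*} [Field k] (h2 : (2 : k) ≠ 0)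
    {m g m' g' S : Fin 3 → k}
    (hm : g ⬝ᵥ m = 0) (hm' : g' ⬝ᵥ m' = 0) (hQ : g 0 ^ 2 + g 1 ^ 2 ≠ 0)
    (hQ' : g' 0 ^ 2 + g' 1 ^ 2 ≠ 0) (hne : m ⨯₃ m' ≠ 0)
    (hT : reflVec m g S = reflVec m' g' S) :
    g ⬝ᵥ S = 0 ∨ normalForm m g S = 0 ∨
      ∃ c : k, S = c • (reflVec m g m' ⨯₃ reflVec m' g' m) := by
  have B1 : reflVec m g m' ⬝ᵥ S = 0 := by
    rw [reflVec_dotProduct_comm hm, hT, reflVec_dotProduct_self]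
  have B2 : reflVec m' g' m ⬝ᵥ S = 0 := by
    rw [reflVec_dotProduct_comm hm', ← hT, reflVec_dotProduct_self]
  by_cases hc : reflVec m g m' ⨯₃ reflVec m' g' m = 0
  swap
  · refine Or.inr (Or.inr (exists_smul_of_cross_eq_zero hc ?_))
    rw [cross_cross_eq_smul_sub_smul, B1, B2]
    simp
  have hne' : m' ⨯₃ m ≠ 0 := by rwa [← cross_anticomm, neg_ne_zero]
  obtain ⟨c, hc⟩ := exists_smul_of_cross_eq_zero (reflVec_ne_zero hm' hQ' hne')
    (by rw [← cross_anticomm, hc, neg_zero])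
  have B3 : reflVec m g m' ⬝ᵥ m' = 0 := by
    rw [hc, smul_dotProduct, reflVec_dotProduct_self, smul_zero]
  have B4 : (2 : k) * ((g ⬝ᵥ m') * normalForm m g m') = 0 := by
    rw [← neg_eq_zero, ← B3]
    simp [reflVec, normalForm, dotProduct, Fin.sum_univ_three]; ring
  -- either `m'` is on the tangent at `m`, or it is on the normal and then so is `S`
  have key : g ⬝ᵥ m' = 0 ∨ normalForm m g S = 0 := by
    rcases mul_eq_zero.1 ((mul_eq_zero.1 B4).resolve_left h2) with h | h
    · exact Or.inl h
    · refine mul_eq_zero.1 ?_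
      simp only [dotProduct, Fin.sum_univ_three] at hm
      simp only [normalForm] at h
      simp only [reflVec, normalForm, dotProduct, Fin.sum_univ_three, Matrix.cons_val] at B1 ⊢
      -- the linear relation between `m`, the normal direction, `m'` and `S`, paired with `g`
      linear_combination -B1 - (g 0 * S 0 + g 1 * S 1 + g 2 * S 2) * h -
        (g 0 * (S 1 * m' 2 - S 2 * m' 1) - g 1 * (S 0 * m' 2 - S 2 * m' 0)) * hm
  rcases key with h | h
  · left
    obtain ⟨u, hu⟩ := exists_smul_of_cross_eq_zero (v := g) hne
      (by rw [cross_cross_eq_smul_sub_smul, dotProduct_comm m, hm, dotProduct_comm m', h]; simp)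
    have : (g 0 ^ 2 + g 1 ^ 2) * ((m ⨯₃ m') ⬝ᵥ S) = 0 := by
      rw [← B1]
      simp only [dotProduct, Fin.sum_univ_three] at h
      simp [reflVec, dotProduct, Fin.sum_univ_three, cross_apply]
      linear_combination 2 * (-(m 2 * g 1) * S 0 + m 2 * g 0 * S 1
        + (m 0 * g 1 - m 1 * g 0) * S 2) * h
    rw [hu, smul_dotProduct, (mul_eq_zero.1 this).resolve_left hQ, smul_zero]
  · exact Or.inr (Or.inl h)

/-! ### Embeddings of fields and transcendence degree -/

/-- An embedding into an algebraically closed field extends along an algebraic extension of a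
domain. -/
theorem exists_ringHom_comp_eq {R Ω₁ Ω₂ : Type*} [CommRing R] [IsDomain R] [Field Ω₁] [Field Ω₂]
    [IsAlgClosed Ω₂] [Algebra R Ω₁] [Algebra.IsAlgebraic R Ω₁] [FaithfulSMul R Ω₁]
    (g : R →+* Ω₂) (hg : Function.Injective g) :
    ∃ σ : Ω₁ →+* Ω₂, ∀ r, σ (algebraMap R Ω₁ r) = g r := by
  let := g.toAlgebra
  have : FaithfulSMul R Ω₂ := (faithfulSMul_iff_algebraMap_injective R Ω₂).2 hg
  exact ⟨(IsAlgClosed.lift : Ω₁ →ₐ[R] Ω₂).toRingHom,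
    fun r => (IsAlgClosed.lift : Ω₁ →ₐ[R] Ω₂).commutes r⟩

/-- An embedding of the polynomial ring on a transcendence basis extends to an endomorphism of the
field. -/
theorem exists_ringHom_extending {M Ω : Type*} [Field M] [Field Ω] [Algebra M Ω] [IsAlgClosed Ω]
    {B : Set Ω} (hB : IsTranscendenceBasis M (Subtype.val : B → Ω))
    (g : MvPolynomial B M →+* Ω) (hg : Function.Injective g) :
    ∃ σ : Ω →+* Ω, (∀ c, σ (algebraMap M Ω c) = g (C c)) ∧ ∀ b : B, σ b = g (X b) := by
  let f := aeval (R := M) (Subtype.val : B → Ω)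
  have hf : Function.Injective f := hB.1
  let := f.toRingHom.toAlgebra
  have : FaithfulSMul (MvPolynomial B M) Ω := (faithfulSMul_iff_algebraMap_injective _ _).2 hf
  have : Algebra.IsAlgebraic (MvPolynomial B M) Ω := by
    have := hB.isAlgebraic
    have hmem (p) : f p ∈ Algebra.adjoin M (Set.range (Subtype.val : B → Ω)) := by
      rw [Algebra.adjoin_range_eq_range_aeval]; exact ⟨p, rfl⟩
    refine Algebra.IsAlgebraic.of_ringHom_of_comp_eq (f.codRestrict _ hmem) (RingHom.id Ω)
      ?_ Function.injective_id rfl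
    rintro ⟨y, hy⟩
    rw [Algebra.adjoin_range_eq_range_aeval] at hy
    obtain ⟨p, hp⟩ := hy
    exact ⟨p, Subtype.ext hp⟩
  obtain ⟨σ, hσ⟩ := exists_ringHom_comp_eq (Ω₁ := Ω) g hg
  refine ⟨σ, fun c => ?_, fun b => ?_⟩
  · rw [← hσ]; congr 1; exact (aeval_C _ c).symm
  · rw [← hσ]; congr 1; exact (aeval_X _ b).symm

/-- Over a field of characteristic zero, the elements of an algebraically closed extension that are
fixed by all endomorphisms are those of the base field. -/
theorem exists_algHom_apply_ne {L Ω : Type*} [Field L] [CharZero L] [Field Ω] [Algebra L Ω]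
    [IsAlgClosed Ω] {t : Ω} (ht : t ∉ Set.range (algebraMap L Ω)) :
    ∃ σ : Ω →ₐ[L] Ω, σ t ≠ t := by
  by_cases hta : IsAlgebraic L t
  · -- move `t` inside the algebraic closure `M` of `L`, and extend to `Ω`
    let M := algebraicClosure L Ω
    let t' : M := ⟨t, mem_algebraicClosure_iff.2 hta⟩
    have : ∃ τ : M ≃ₐ[L] M, τ t' ≠ t' := by
      by_contra! hcon
      obtain ⟨l, hl⟩ := IntermediateField.mem_bot.1
        ((InfiniteGalois.mem_bot_iff_fixed (k := L) t').2 hcon)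
      exact ht ⟨l, congrArg Subtype.val hl⟩
    obtain ⟨τ, hτ⟩ := this
    obtain ⟨B, hB⟩ := exists_isTranscendenceBasis M Ω
    let g := (aeval (R := M) (Subtype.val : B → Ω)).toRingHom.comp
      (MvPolynomial.map (σ := B) (τ : M →+* M))
    have hg : Function.Injective g := by
      have h1 : Function.Injective (aeval (R := M) (Subtype.val : B → Ω)) := hB.1
      exact h1.comp (MvPolynomial.map_injective _ τ.injective)
    obtain ⟨σ, hσ, -⟩ := exists_ringHom_extending hB g hg
    have hσM (c : M) : σ c = τ c := by
      rw [show (c : Ω) = algebraMap M Ω c from rfl, hσ]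
      simp [g]
    refine ⟨{ σ with commutes' := fun l => ?_ }, fun h => hτ (Subtype.ext ?_)⟩
    · have := hσM (algebraMap L M l)
      rw [τ.commutes] at this
      exact this
    · rw [← hσM]
      exact h
  · -- complete `t` to a transcendence basis, and replace `t` by `t + 1` in it
    have hti : AlgebraicIndepOn L id ({t} : Set Ω) := by
      apply (algebraicIndependent_singleton_iff (⟨t, rfl⟩ : ({t} : Set Ω))).2
      exact hta
    obtain ⟨B, htB, hB⟩ := exists_isTranscendenceBasis_superset hti
    classical
    let e (c : L) : MvPolynomial B L →ₐ[L] MvPolynomial B L :=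
      aeval (fun b => X b + if (b : Ω) = t then C c else 0)
    have he : Function.Injective (e 1) := by
      have : (e (-1)).comp (e 1) = AlgHom.id L _ := by
        apply MvPolynomial.algHom_ext
        intro b
        by_cases h : (b : Ω) = t
        · simp [e, h]
        · simp [e, h]
      have hl (p) : e (-1) (e 1 p) = p := AlgHom.congr_fun this p
      exact Function.LeftInverse.injective hl
    let g := (aeval (R := L) (Subtype.val : B → Ω)).toRingHom.comp (e 1).toRingHom
    have hg : Function.Injective g := by
      have h1 : Function.Injective (aeval (R := L) (Subtype.val : B → Ω)) := hB.1
      exact h1.comp he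
    obtain ⟨σ, hσ, hσ'⟩ := exists_ringHom_extending hB g hg
    refine ⟨{ σ with commutes' := fun l => ?_ }, ?_⟩
    · change σ (algebraMap L Ω l) = _
      rw [hσ]
      simp [g, e]
    · change σ t ≠ t
      have := hσ' ⟨t, htB rfl⟩
      simp only [g, e, AlgHom.toRingHom_eq_coe, RingHom.comp_apply, RingHom.coe_coe, aeval_X,
        if_true, map_add, map_one] at this
      rw [this]
      simp

/-- If `n` algebraically independent elements lie in the field generated by `n` elements, then
these are algebraically independent as well. -/
theorem algebraicIndependent_of_mem_adjoin {K Ω : Type*} [Field K] [Field Ω] [Algebra K Ω]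
    {n : ℕ} {z a : Fin n → Ω} (ha : AlgebraicIndependent K a)
    (haz : ∀ i, a i ∈ IntermediateField.adjoin K (Set.range z)) :
    AlgebraicIndependent K z := by
  let M := IntermediateField.adjoin K (Set.range z)
  let z' : Fin n → M := fun i => ⟨z i, IntermediateField.subset_adjoin K _ ⟨i, rfl⟩⟩
  let a' : Fin n → M := fun i => ⟨a i, haz i⟩
  have ha' : AlgebraicIndependent K a' := AlgebraicIndependent.of_comp M.val ha
  have hval (q : MvPolynomial (Fin n) K) : M.val (aeval z' q) = aeval z q := by
    rw [← AlgHom.comp_apply, MvPolynomial.comp_aeval]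
    rfl
  have : Algebra.IsAlgebraic (Algebra.adjoin K (Set.range z')) M := by
    constructor
    rintro ⟨y, hy⟩
    obtain ⟨r, s, h⟩ := (IntermediateField.mem_adjoin_range_iff K z y).1 hy
    have : (⟨y, hy⟩ : M) = aeval z' r * (aeval z' s)⁻¹ := by
      apply Subtype.ext
      change y = M.val (aeval z' r * (aeval z' s)⁻¹)
      rw [map_mul, map_inv₀, hval, hval, h, div_eq_mul_inv]
    have hz' (q : MvPolynomial (Fin n) K) :
        IsAlgebraic (Algebra.adjoin K (Set.range z')) (aeval z' q) := by
      have hq : aeval z' q ∈ Algebra.adjoin K (Set.range z') := by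
        rw [Algebra.adjoin_range_eq_range_aeval]; exact ⟨q, rfl⟩
      exact isAlgebraic_algebraMap (⟨_, hq⟩ : Algebra.adjoin K (Set.range z'))
    rw [this]
    exact (hz' r).mul (hz' s).inv
  have hz := Algebra.IsAlgebraic.isTranscendenceBasis_of_lift_le_trdeg_of_finite K z'
    ha'.lift_cardinalMk_le_trdeg
  exact hz.1.map' (f := M.val) M.val.injective

/-! ### Zeros of irreducible forms, and isotropic tangents -/

theorem dvd_of_forall_eval_eq_zero {σ : Type*} [Finite σ] {F H : MvPolynomial σ ℂ}
    (hF : Irreducible F) (h : ∀ v, eval v F = 0 → eval v H = 0) : F ∣ H := by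
  have hp : (Ideal.span {F}).IsPrime := (Ideal.span_singleton_prime hF.ne_zero).2 hF.prime
  have : H ∈ vanishingIdeal ℂ (zeroLocus ℂ (Ideal.span {F})) := by
    intro v hv
    rw [aeval_eq_eval]
    exact h v (by simpa [aeval_eq_eval] using hv F (Ideal.mem_span_singleton_self F))
  rw [vanishingIdeal_zeroLocus_eq_radical, hp.radical, Ideal.mem_span_singleton] at this
  exact this

/-- A non-constant polynomial whose zeros are all zeros of `F` is a multiple of the irreducible
polynomial `F`. -/
theorem dvd_of_forall_eval_eq_zero_of_not_isUnit {σ : Type*} [Finite σ] {F H : MvPolynomial σ ℂ}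
    (hF : Irreducible F) (hH : ¬ IsUnit H) (h : ∀ v, eval v H = 0 → eval v F = 0) : F ∣ H := by
  by_cases hH0 : H = 0
  · exact hH0 ▸ dvd_zero F
  obtain ⟨P, hP, hPH⟩ := WfDvdMonoid.exists_irreducible_factor hH hH0
  have : P ∣ F := dvd_of_forall_eval_eq_zero hP fun v hv => h v (by
    obtain ⟨Q, rfl⟩ := hPH
    simp [hv])
  exact ((hP.associated_of_dvd hF this).symm.dvd).trans hPH

theorem eq_zero_of_dvd_of_isHomogeneous {σ : Type*} {F H : MvPolynomial σ ℂ} {d e : ℕ}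
    (hF : F.IsHomogeneous d) (hH : H.IsHomogeneous e) (hed : e < d) (h : F ∣ H) : H = 0 := by
  by_contra hH0
  obtain ⟨Q, rfl⟩ := h
  have h0 := mul_ne_zero_iff.1 hH0
  have h1 := hH.totalDegree hH0
  rw [totalDegree_mul_of_isDomain h0.1 h0.2, hF.totalDegree h0.1] at h1
  omega

theorem aeval_smul_of_isHomogeneous {σ R A : Type*} [Fintype σ] [CommRing R] [CommRing A]
    [Algebra R A] {F : MvPolynomial σ R} {d : ℕ} (hF : F.IsHomogeneous d) (t : A) (v : σ → A) :
    aeval (t • v) F = t ^ d * aeval v F := by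
  rw [aeval_def, aeval_def, eval₂_eq', eval₂_eq', Finset.mul_sum]
  refine Finset.sum_congr rfl fun m hm => ?_
  have hdeg : ∑ i, m i = d := by
    rw [← Finsupp.degree_eq_sum]
    by_contra h
    exact mem_support_iff.1 hm (hF.coeff_eq_zero h)
  simp only [Pi.smul_apply, smul_eq_mul, mul_pow, Finset.prod_mul_distrib,
    Finset.prod_pow_eq_pow_sum, hdeg]
  ring

theorem eval_smul_of_isHomogeneous {σ R : Type*} [Fintype σ] [CommRing R]
    {F : MvPolynomial σ R} {d : ℕ} (hF : F.IsHomogeneous d) (t : R) (v : σ → R) :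
    eval (t • v) F = t ^ d * eval v F := by
  simpa only [aeval_eq_eval] using aeval_smul_of_isHomogeneous hF t v

/-- The chain rule for the restriction of a polynomial to the line `v + t e`. -/
theorem derivative_aeval_line {R σ : Type*} [CommRing R] [Fintype σ] (v e : σ → R)
    (F : MvPolynomial σ R) :
    Polynomial.derivative (aeval (fun j => Polynomial.C (v j) + Polynomial.C (e j) * .X) F) =
      ∑ j, Polynomial.C (e j) *
        aeval (fun j => Polynomial.C (v j) + Polynomial.C (e j) * .X) (pderiv j F) := by
  induction F using MvPolynomial.induction_on with
  | C a => simp [Polynomial.algebraMap_eq]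
  | add p q hp hq => simp [hp, hq, mul_add, Finset.sum_add_distrib]
  | mul_X p i hp =>
    classical
    have (j : σ) : (pderiv j (X i : MvPolynomial σ R)) = if j = i then 1 else 0 := by
      rw [pderiv_X, Pi.single_apply]; simp only [eq_comm]
    simp only [map_mul, aeval_X, Polynomial.derivative_mul, hp, Derivation.leibniz, smul_eq_mul,
      map_add, this, mul_add, Finset.sum_add_distrib,
      Polynomial.derivative_C, Polynomial.derivative_X]
    simp [Finset.sum_mul]
    rw [← add_assoc, ← Finset.sum_add_distrib, add_comm, mul_comm]
    congr 1
    exact Finset.sum_congr rfl fun x _ => by ring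

theorem eval_add_smul_of_sum_pderiv_eq_zero {σ : Type*} [Fintype σ] {F : MvPolynomial σ ℂ}
    {e : σ → ℂ} (h : ∑ j, C (e j) * pderiv j F = 0) (v : σ → ℂ) (t : ℂ) :
    eval (v + t • e) F = eval v F := by
  set f := aeval (fun j => Polynomial.C (v j) + Polynomial.C (e j) * .X) F with hf
  have hd : Polynomial.derivative f = 0 := by
    rw [hf, derivative_aeval_line]
    have := congrArg (aeval (fun j => Polynomial.C (v j) + Polynomial.C (e j) * .X)) h
    simpa [Polynomial.algebraMap_eq] using this
  have hev (s : ℂ) : f.eval s = eval (v + s • e) F := by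
    rw [hf, ← Polynomial.coe_aeval_eq_eval, ← AlgHom.restrictScalars_apply ℂ,
      ← AlgHom.comp_apply, comp_aeval, aeval_eq_eval]
    congr 2
    ext j
    simp only [AlgHom.restrictScalars_apply, Polynomial.coe_aeval_eq_eval, Polynomial.eval_add,
      Polynomial.eval_mul, Polynomial.eval_C, Polynomial.eval_X, Pi.add_apply, Pi.smul_apply,
      smul_eq_mul, mul_comm s]
  have hc := Polynomial.eq_C_of_derivative_eq_zero hd
  rw [← hev, hc]
  have := hev 0
  rw [hc] at this
  simpa using this

theorem not_dvd_X {F : MvPolynomial (Fin 3) ℂ} {d : ℕ} (hd : 2 ≤ d) (hF : F.IsHomogeneous d)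
    (i : Fin 3) : ¬ F ∣ X i :=
  fun h => X_ne_zero i (eq_zero_of_dvd_of_isHomogeneous hF (isHomogeneous_X ℂ i) hd h)

/-- An irreducible curve of degree at least two is not a cone with vertex `(1, ε, 0)`: otherwise it
would contain the line joining the vertex to one of its other points. -/
theorem pderiv_add_ne_zero {F : MvPolynomial (Fin 3) ℂ} {d : ℕ} (hd : 2 ≤ d)
    (hF : F.IsHomogeneous d) (hirr : Irreducible F) (ε : ℂ) :
    pderiv 0 F + C ε * pderiv 1 F ≠ 0 := by
  intro h
  have hconst := eval_add_smul_of_sum_pderiv_eq_zero (F := F) (e := ![1, ε, 0])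
    (by simpa [Fin.sum_univ_three] using h)
  obtain ⟨p, hp, hp2⟩ : ∃ p, eval p F = 0 ∧ eval p (X 2 : MvPolynomial (Fin 3) ℂ) ≠ 0 := by
    by_contra! hcon
    exact not_dvd_X hd hF 2 (dvd_of_forall_eval_eq_zero hirr hcon)
  rw [eval_X] at hp2
  -- the line through `p` and `(1, ε, 0)`
  let H : MvPolynomial (Fin 3) ℂ :=
    C (-ε * p 2) * X 0 + C (p 2) * X 1 + C (p 0 * ε - p 1) * X 2
  have hH : H.IsHomogeneous 1 :=
    ((isHomogeneous_C_mul_X _ 0).add (isHomogeneous_C_mul_X _ 1)).add (isHomogeneous_C_mul_X _ 2)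
  have hH0 : H ≠ 0 := by
    intro h0
    have := congrArg (eval ![0, 1, 0]) h0
    simp [H, hp2] at this
  have hdvd : F ∣ H := by
    refine dvd_of_forall_eval_eq_zero_of_not_isUnit hirr (fun hu => ?_) fun v hv => ?_
    · have h1 := hH.totalDegree hH0
      rw [isUnit_iff_totalDegree_of_isReduced] at hu
      omega
    · have hv' : v = (v 2 / p 2) • p + (v 0 - v 2 / p 2 * p 0) • ![1, ε, 0] := by
        simp [H] at hv
        ext i
        fin_cases i
        · simp
        · simp; field_simp; linear_combination hv
        · simp [hp2]
      rw [hv', hconst, eval_smul_of_isHomogeneous hF, hp, mul_zero]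
  exact hH0 (eq_zero_of_dvd_of_isHomogeneous hF hH hd hdvd)

/-- The tangent at a general point of the curve is not isotropic: `F_x ^ 2 + F_y ^ 2` is the product
of `F_x + i F_y` and `F_x - i F_y`, neither of which is divisible by `F`. -/
theorem not_dvd_gradQ {F : MvPolynomial (Fin 3) ℂ} {d : ℕ} (hd : 2 ≤ d)
    (hF : F.IsHomogeneous d) (hirr : Irreducible F) : ¬ F ∣ gradQ F := by
  have hD : ∀ (ε : ℂ), ¬ F ∣ pderiv 0 F + C ε * pderiv 1 F := fun ε h =>
    pderiv_add_ne_zero hd hF hirr ε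
      (eq_zero_of_dvd_of_isHomogeneous hF (hF.pderiv.add (hF.pderiv.C_mul ε)) (by omega) h)
  have : gradQ F = (pderiv 0 F + C Complex.I * pderiv 1 F) *
      (pderiv 0 F + C (-Complex.I) * pderiv 1 F) := by
    have : (C Complex.I * C Complex.I : MvPolynomial (Fin 3) ℂ) = -1 := by
      rw [← C_mul, Complex.I_mul_I, C_neg, C_1]
    rw [gradQ, C_neg]
    linear_combination (pderiv 1 F) ^ 2 * this
  rw [this]
  exact fun h => (hirr.prime.dvd_or_dvd h).elim (hD _) (hD _)

/-! ### The reflected line of a generic source -/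

/-- The gradient of `F` at a point with coordinates in a `ℂ`-algebra. -/
noncomputable def gradVec {A : Type*} [CommRing A] [Algebra ℂ A] (F : MvPolynomial (Fin 3) ℂ)
    (x : Fin 3 → A) : Fin 3 → A :=
  fun i => aeval x (pderiv i F)

theorem gradVec_dotProduct_self {A : Type*} [CommRing A] [Algebra ℂ A]
    {F : MvPolynomial (Fin 3) ℂ} {d : ℕ} (hF : F.IsHomogeneous d) {x : Fin 3 → A}
    (hx : aeval x F = 0) : gradVec F x ⬝ᵥ x = 0 := by
  have := congrArg (aeval x) hF.sum_X_mul_pderiv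
  rw [map_nsmul, hx, smul_zero] at this
  simpa [dotProduct, gradVec, mul_comm] using this

theorem gradVec_smul {A : Type*} [CommRing A] [Algebra ℂ A]
    {F : MvPolynomial (Fin 3) ℂ} {d : ℕ} (hF : F.IsHomogeneous d) (t : A) (x : Fin 3 → A) :
    gradVec F (t • x) = t ^ (d - 1) • gradVec F x := by
  ext i
  exact aeval_smul_of_isHomogeneous hF.pderiv t x

theorem map_aeval_comp {A B : Type*} [CommRing A] [Algebra ℂ A] [CommRing B] [Algebra ℂ B]
    (f : A →ₐ[ℂ] B) (F : MvPolynomial (Fin 3) ℂ) (x : Fin 3 → A) :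
    f (aeval x F) = aeval (f ∘ x) F := by
  rw [← AlgHom.comp_apply, comp_aeval]
  rfl

theorem map_gradVec {A B : Type*} [CommRing A] [Algebra ℂ A] [CommRing B] [Algebra ℂ B]
    (f : A →ₐ[ℂ] B) (F : MvPolynomial (Fin 3) ℂ) (x : Fin 3 → A) :
    f ∘ gradVec F x = gradVec F (f ∘ x) :=
  funext fun i => map_aeval_comp f (pderiv i F) x

theorem eval_reflectedForms (F : MvPolynomial (Fin 3) ℂ) (s v : Fin 3 → ℂ) (j : Fin 3) :
    eval v (reflectedForms F s j) = reflVec v (gradVec F v) s j := by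
  fin_cases j <;> simp [reflectedForms, reflVec, gradVec, gradQ, polarForm, aeval_eq_eval]

theorem AlgebraicIndependent.linear_coeff_eq_zero {K Ω : Type*} [Field K] [CommRing Ω] [Algebra K Ω]
    {a : Fin 3 → Ω} (ha : AlgebraicIndependent K a) {c : Fin 3 → K}
    (h : ∑ i, algebraMap K Ω (c i) * a i = 0) (i : Fin 3) : c i = 0 := by
  have := (AlgebraicIndependent.linearIndependent ha)
  rw [Fintype.linearIndependent_iff] at this
  exact this c (by simpa [Algebra.smul_def] using h) i

/-- The affine coordinates of a point of a curve are algebraically dependent. -/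
theorem not_algebraicIndependent_of_aeval_eq_zero {K Ω : Type*} [Field K] [Field Ω] [Algebra ℂ K]
    [Algebra K Ω] [Algebra ℂ Ω] [IsScalarTower ℂ K Ω] {F : MvPolynomial (Fin 3) ℂ} {d : ℕ}
    (hF : F.IsHomogeneous d) (hF0 : F ≠ 0) {p q : Ω} (hpq : aeval ![p, q, 1] F = 0) (r : Ω) :
    ¬ AlgebraicIndependent K ![p, q, r] := by
  intro h
  let G : MvPolynomial (Fin 3) ℂ := aeval ![X 0, X 1, 1] F
  have hG : G = 0 := by
    have h' : AlgebraicIndependent ℂ ![p, q, r] :=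
      h.restrictScalars (algebraMap ℂ K).injective
    apply h'
    rw [map_zero, ← hpq, ← AlgHom.comp_apply, comp_aeval]
    congr 2
    ext i
    fin_cases i <;> simp
  apply (mul_ne_zero (X_ne_zero 2) hF0 : (X 2 : MvPolynomial (Fin 3) ℂ) * F ≠ 0)
  apply MvPolynomial.funext
  intro v
  rw [map_mul, eval_X, map_zero]
  by_cases hv : v 2 = 0
  · rw [hv, zero_mul]
  · have h1 : v = v 2 • ![v 0 / v 2, v 1 / v 2, 1] := by
      ext i; fin_cases i <;> simp <;> field_simp
    have h2 := congrArg (eval ![v 0 / v 2, v 1 / v 2, 1]) hG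
    rw [map_zero, ← aeval_eq_eval, ← AlgHom.comp_apply, comp_aeval, aeval_eq_eval] at h2
    rw [h1, eval_smul_of_isHomogeneous hF]
    rw [show eval ![v 0 / v 2, v 1 / v 2, 1] F = 0 from ?_]
    · simp
    · rw [← h2]
      congr 2
      ext i
      fin_cases i <;> simp

/-- When the coordinates of the source `a` are algebraically independent over a field that contains
the coordinates of the point `x` of the curve, the reflected line determines this point rationally:
the ratios `x i / x 2` belong to the field generated by the coordinates of the source and of the
reflected line. -/
theorem div_mem_adjoin_reflVec {K Ω : Type*} [Field K] [Field Ω] [Algebra ℂ K]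
    [Algebra K Ω] [Algebra ℂ Ω] [IsScalarTower ℂ K Ω] [IsAlgClosed Ω]
    {F : MvPolynomial (Fin 3) ℂ} {d : ℕ} (hF : F.IsHomogeneous d) (hF0 : F ≠ 0)
    {x : Fin 3 → K} (hx : aeval x F = 0) (hQ : aeval x (gradQ F) ≠ 0) (hx2 : x 2 ≠ 0)
    {a : Fin 3 → Ω} (ha : AlgebraicIndependent K a) (i : Fin 3) :
    algebraMap K Ω (x i / x 2) ∈ IntermediateField.adjoin ℂ (Set.range
      (Sum.elim a (reflVec (algebraMap K Ω ∘ x) (gradVec F (algebraMap K Ω ∘ x)) a))) := by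
  set m := algebraMap K Ω ∘ x with hm
  set T := reflVec m (gradVec F m) a with hT
  by_contra hcon
  set L := IntermediateField.adjoin ℂ (Set.range (Sum.elim a T)) with hL
  obtain ⟨σ, hσ⟩ := exists_algHom_apply_ne (L := L) (t := algebraMap K Ω (x i / x 2))
    (by rintro ⟨l, hl⟩; exact hcon (hl ▸ l.2))
  -- `σ` fixes the source and the reflected line, and moves `m` to another point `m'` of the curve
  have hσL (z : Ω) (hz : z ∈ Set.range (Sum.elim a T)) : σ z = z :=
    σ.commutes ⟨z, IntermediateField.subset_adjoin ℂ _ hz⟩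
  let σ' : Ω →ₐ[ℂ] Ω := σ.restrictScalars ℂ
  have hσa : σ ∘ a = a := funext fun j => hσL _ ⟨Sum.inl j, rfl⟩
  have hσT : σ ∘ T = T := funext fun j => hσL _ ⟨Sum.inr j, rfl⟩
  let j := IsScalarTower.toAlgHom ℂ K Ω
  have hj : ⇑j = algebraMap K Ω := IsScalarTower.coe_toAlgHom' ℂ K Ω
  have hg : gradVec F m = algebraMap K Ω ∘ gradVec F x := by rw [hm, ← hj, map_gradVec]
  have : CharZero Ω := charZero_of_injective_algebraMap (algebraMap ℂ Ω).injective
  have hxQ : gradVec F x 0 ^ 2 + gradVec F x 1 ^ 2 ≠ 0 := by simpa [gradQ, gradVec] using hQ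
  have hmF : aeval m F = 0 := by
    rw [hm, ← hj, ← map_aeval_comp, hx, map_zero]
  set m' := σ ∘ m with hm'
  have hmF' : aeval m' F = 0 :=
    (map_aeval_comp σ' F m).symm.trans (by rw [hmF, map_zero])
  have hm2 : m 2 ≠ 0 := by simpa [hm] using hx2
  have hm2' : m' 2 ≠ 0 := by simpa [hm'] using hm2
  have hg' : σ ∘ gradVec F m = gradVec F m' := map_gradVec σ' F m
  have hmQ : gradVec F m 0 ^ 2 + gradVec F m 1 ^ 2 ≠ 0 := by
    rw [hg]
    simpa [← map_pow, ← map_add] using hxQ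
  have hmQ' : gradVec F m' 0 ^ 2 + gradVec F m' 1 ^ 2 ≠ 0 := by
    rw [← hg']
    simpa [← map_pow, ← map_add] using hmQ
  have hT' : reflVec m (gradVec F m) a = reflVec m' (gradVec F m') a := by
    rw [← hT, ← hσT]
    ext j
    have := map_reflVec σ.toRingHom m (gradVec F m) a j
    simpa [hg', hσa] using this
  have hne : m ⨯₃ m' ≠ 0 := by
    intro h0
    have hm0 : m ≠ 0 := fun h => hm2 (by rw [h]; rfl)
    obtain ⟨c, hc⟩ := exists_smul_of_cross_eq_zero hm0 h0
    apply hσ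
    have h1 (j : Fin 3) : σ (algebraMap K Ω (x j)) = c * algebraMap K Ω (x j) := congrFun hc j
    have hc0 : c ≠ 0 := by rintro rfl; simp [hc] at hm2'
    rw [map_div₀, map_div₀, h1, h1, mul_div_mul_left _ _ hc0]
  rcases tangent_or_normal_or_eq_smul_cross two_ne_zero (gradVec_dotProduct_self hF hmF)
    (gradVec_dotProduct_self hF hmF') hmQ hmQ' hne hT' with h | h | ⟨c, hc⟩
  · -- `a` would lie on the tangent at `m`
    have h0 := ha.linear_coeff_eq_zero (c := gradVec F x)
      (by simpa [hg, dotProduct] using h)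
    simp [h0] at hxQ
  · -- `a` would lie on the normal at `m`
    have h0 := ha.linear_coeff_eq_zero (c := ![-(x 2 * gradVec F x 1), x 2 * gradVec F x 0,
      x 0 * gradVec F x 1 - x 1 * gradVec F x 0])
      (by rw [hg] at h; simpa [hm, normalForm, Fin.sum_univ_three] using h)
    have h1 := h0 0
    have h2 := h0 1
    simp [hx2] at h1 h2
    simp [h1, h2] at hxQ
  · -- `a` would be determined by `m'` and a scalar
    set p := m' 0 / m' 2
    set q := m' 1 / m' 2
    have hy : m' = m' 2 • ![p, q, 1] := by
      ext k; fin_cases k <;> simp [p, q] <;> field_simp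
    have hpq : aeval ![p, q, 1] F = 0 := by
      rw [hy, aeval_smul_of_isHomogeneous hF] at hmF'
      exact (mul_eq_zero.1 hmF').resolve_left (pow_ne_zero _ hm2')
    obtain ⟨r, hr⟩ : ∃ r, a = r • (reflVec m (gradVec F m) ![p, q, 1] ⨯₃
        reflVec ![p, q, 1] (gradVec F ![p, q, 1]) m) := by
      rw [hy, gradVec_smul hF, reflVec_smul_source, reflVec_smul_point] at hc
      simp only [map_smul, LinearMap.smul_apply, smul_smul] at hc
      exact ⟨_, hc⟩
    refine not_algebraicIndependent_of_aeval_eq_zero (K := K) hF hF0 hpq r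
      (algebraicIndependent_of_mem_adjoin ha ?_)
    set E := IntermediateField.adjoin K (Set.range ![p, q, r]) with hE
    have hz (k : Fin 3) : ![p, q, r] k ∈ E := IntermediateField.subset_adjoin K _ ⟨k, rfl⟩
    let ι : E →ₐ[ℂ] Ω := E.val.restrictScalars ℂ
    let yE : Fin 3 → E := ![⟨p, hz 0⟩, ⟨q, hz 1⟩, 1]
    have hyE : ι ∘ yE = ![p, q, 1] := by
      ext k; fin_cases k <;> rfl
    have hmE : ι ∘ algebraMap K E ∘ x = m := rfl
    have e1 (k : Fin 3) : reflVec m (gradVec F m) ![p, q, 1] k ∈ E := by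
      rw [← hmE, ← hyE, ← map_gradVec ι]
      exact map_reflVec ι.toRingHom (algebraMap K E ∘ x) _ yE k ▸ Subtype.coe_prop _
    have e2 (k : Fin 3) : reflVec ![p, q, 1] (gradVec F ![p, q, 1]) m k ∈ E := by
      rw [← hmE, ← hyE, ← map_gradVec ι]
      exact map_reflVec ι.toRingHom yE _ (algebraMap K E ∘ x) k ▸ Subtype.coe_prop _
    intro k
    rw [hr, Pi.smul_apply, smul_eq_mul]
    refine mul_mem (hz 2) ?_
    rw [cross_apply]
    fin_cases k <;> exact sub_mem (mul_mem (e1 _) (e2 _)) (mul_mem (e1 _) (e2 _))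

/-! ### Rational maps of the plane with a left inverse on a curve -/

theorem vanishesAt_mk {f : MvPolynomial (Fin 3) ℂ} {n : ℕ} (hf : f.IsHomogeneous n)
    {v : Fin 3 → ℂ} (hv : v ≠ 0) : VanishesAt f (Projectivization.mk ℂ v hv) ↔ eval v f = 0 := by
  obtain ⟨a, ha⟩ := Projectivization.exists_smul_eq_mk_rep ℂ v hv
  rw [VanishesAt, ← ha, Units.smul_def, eval_smul_of_isHomogeneous hf]
  simp

namespace ProjRatMap

theorem evalVec_smul (φ : ProjRatMap) (t : ℂ) (v : Fin 3 → ℂ) :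
    φ.evalVec (t • v) = t ^ φ.degree • φ.evalVec v :=
  funext fun i => eval_smul_of_isHomogeneous (φ.homogeneous i) t v

theorem evalVec_zero (φ : ProjRatMap) (hφ : 0 < φ.degree) : φ.evalVec 0 = 0 := by
  have := φ.evalVec_smul 0 0
  rwa [smul_zero, zero_pow hφ.ne', zero_smul] at this

theorem hasValue_mk_of_eq_smul (φ : ProjRatMap) {v w : Fin 3 → ℂ} (hv : v ≠ 0) (hw : w ≠ 0) {c : ℂ}
    (hc : c ≠ 0) (h : φ.evalVec v = c • w) :
    φ.HasValue (Projectivization.mk ℂ v hv) (Projectivization.mk ℂ w hw) := by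
  obtain ⟨a, ha⟩ := Projectivization.exists_smul_eq_mk_rep ℂ v hv
  have h1 : φ.evalVec (Projectivization.mk ℂ v hv).rep = ((a : ℂ) ^ φ.degree * c) • w := by
    rw [← ha, Units.smul_def, evalVec_smul, h, smul_smul]
  have h2 : (a : ℂ) ^ φ.degree * c ≠ 0 := mul_ne_zero (pow_ne_zero _ a.ne_zero) hc
  refine ⟨h1 ▸ smul_ne_zero h2 hw, ?_⟩
  rw [Projectivization.mk_eq_mk_iff']
  exact ⟨_, h1.symm⟩

/-- The composite `ψ ∘ φ` of the rational maps given by `ψ` and `φ`. -/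
noncomputable def comp (ψ φ : ProjRatMap) : ProjRatMap where
  degree := φ.degree * ψ.degree
  forms i := aeval φ.forms (ψ.forms i)
  homogeneous i := (ψ.homogeneous i).aeval φ.forms φ.homogeneous

theorem eval_aeval_forms (φ : ProjRatMap) (f : MvPolynomial (Fin 3) ℂ) (v : Fin 3 → ℂ) :
    eval v (aeval φ.forms f) = eval (φ.evalVec v) f := by
  rw [← aeval_eq_eval, ← aeval_eq_eval, map_aeval_comp]
  rfl

theorem evalVec_comp (ψ φ : ProjRatMap) (v : Fin 3 → ℂ) :
    (ψ.comp φ).evalVec v = ψ.evalVec (φ.evalVec v) := by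
  ext i
  change eval v (aeval φ.forms (ψ.forms i)) = eval (φ.evalVec v) (ψ.forms i)
  exact φ.eval_aeval_forms (ψ.forms i) v

theorem isZariskiOpen_evalVec_ne_zero (φ : ProjRatMap) :
    IsZariskiOpen {p | φ.evalVec p.rep ≠ 0} := by
  refine ⟨Set.range φ.forms, ?_, ?_⟩
  · rintro _ ⟨i, rfl⟩
    exact ⟨_, φ.homogeneous i⟩
  · ext p
    simp [VanishesAt, funext_iff, evalVec]

theorem evalVec_rep_mk_ne_zero (φ : ProjRatMap) {v : Fin 3 → ℂ} (hv : v ≠ 0)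
    (h : φ.evalVec v ≠ 0) : φ.evalVec (Projectivization.mk ℂ v hv).rep ≠ 0 := by
  obtain ⟨a, ha⟩ := Projectivization.exists_smul_eq_mk_rep ℂ v hv
  rw [← ha, Units.smul_def, evalVec_smul]
  exact smul_ne_zero (pow_ne_zero _ a.ne_zero) h

/-- A form that vanishes on the image of `φ` vanishes on its closure. -/
theorem eval_rep_eq_zero_of_mem_imageClosure (φ : ProjRatMap) {X : Set ProjPlane}
    {f : MvPolynomial (Fin 3) ℂ} {n : ℕ} (hf : f.IsHomogeneous n)
    (h : ∀ p ∈ X, eval (φ.evalVec p.rep) f = 0) {q : ProjPlane} (hq : q ∈ φ.imageClosure X) :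
    eval q.rep f = 0 := by
  refine hq {q | VanishesAt f q} ⟨⟨{f}, ?_, ?_⟩, ?_⟩
  · rintro _ rfl
    exact ⟨n, hf⟩
  · simp
  · rintro _ ⟨p, hp, h0, rfl⟩
    exact (vanishesAt_mk hf h0).2 (h p hp)

theorem mk_evalVec_mem_imageClosure (φ : ProjRatMap) {X : Set ProjPlane} {p : ProjPlane}
    (hp : p ∈ X) (h : φ.evalVec p.rep ≠ 0) :
    Projectivization.mk ℂ (φ.evalVec p.rep) h ∈ φ.imageClosure X :=
  fun _ hZ => hZ.2 ⟨p, hp, h, rfl⟩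

end ProjRatMap

theorem exists_eq_smul_of_mul_eq_mul {k : Type*} [Field k] {u v : Fin 3 → k} (hv : v ≠ 0)
    (h : ∀ i j, u i * v j = u j * v i) : ∃ c : k, u = c • v := by
  obtain ⟨j, hj⟩ := Function.ne_iff.1 hv
  refine ⟨u j / v j, funext fun i => ?_⟩
  rw [Pi.smul_apply, smul_eq_mul, div_mul_eq_mul_div, eq_div_iff hj, h]

/-- If `ψ ∘ φ` is the identity on the curve `V(F)`, wherever it is defined, and if it is defined
somewhere, then `φ` is birational from `V(F)` onto its image. -/
theorem ProjRatMap.isBirationalOntoImageOn_of_leftInverse {F : MvPolynomial (Fin 3) ℂ} {d : ℕ}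
    (hF : F.IsHomogeneous d) (φ ψ : ProjRatMap) (hφ : 0 < φ.degree)
    (hψ : 0 < ψ.degree)
    (h : ∀ v, eval v F = 0 → ∀ i j,
      ψ.evalVec (φ.evalVec v) i * v j = ψ.evalVec (φ.evalVec v) j * v i)
    (hne : ∃ v, eval v F = 0 ∧ ψ.evalVec (φ.evalVec v) ≠ 0) :
    φ.IsBirationalOntoImageOn (planeCurve F) := by
  have hsmul (v : Fin 3 → ℂ) (hv : v ≠ 0) (hFv : eval v F = 0) :
      ∃ c : ℂ, ψ.evalVec (φ.evalVec v) = c • v :=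
    exists_eq_smul_of_mul_eq_mul hv (h v hFv)
  let χ := ψ.comp φ
  let ω := χ.comp ψ
  have hχ (v) : χ.evalVec v = ψ.evalVec (φ.evalVec v) := evalVec_comp ψ φ v
  have hω (v) : ω.evalVec v = ψ.evalVec (φ.evalVec (ψ.evalVec v)) := by
    rw [evalVec_comp, hχ]
  -- on the closure of the image, `ψ` takes its values in the curve and `φ ∘ ψ` is the identity
  have hYF {q} (hq : q ∈ φ.imageClosure (planeCurve F)) : eval (ψ.evalVec q.rep) F = 0 := by
    rw [← ψ.eval_aeval_forms]
    refine φ.eval_rep_eq_zero_of_mem_imageClosure (hF.aeval ψ.forms ψ.homogeneous)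
      (fun p hp => ?_) hq
    obtain ⟨c, hc⟩ := hsmul p.rep p.rep_nonzero hp
    rw [ψ.eval_aeval_forms, hc, eval_smul_of_isHomogeneous hF]
    exact mul_eq_zero_of_right _ hp
  have hYφ {q} (hq : q ∈ φ.imageClosure (planeCurve F)) (i j : Fin 3) :
      φ.evalVec (ψ.evalVec q.rep) i * q.rep j = φ.evalVec (ψ.evalVec q.rep) j * q.rep i := by
    have e (v i) : eval v ((φ.comp ψ).forms i) = φ.evalVec (ψ.evalVec v) i :=
      congrFun (evalVec_comp φ ψ v) i
    have := φ.eval_rep_eq_zero_of_mem_imageClosure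
      (f := (φ.comp ψ).forms i * X j - (φ.comp ψ).forms j * X i)
      ((((φ.comp ψ).homogeneous i).mul (isHomogeneous_X ℂ j)).sub
        (((φ.comp ψ).homogeneous j).mul (isHomogeneous_X ℂ i))) (fun p hp => ?_) hq
    · rw [map_sub, map_mul, map_mul, e, e, eval_X, eval_X] at this
      exact sub_eq_zero.1 this
    · obtain ⟨c, hc⟩ := hsmul p.rep p.rep_nonzero hp
      rw [map_sub, map_mul, map_mul, e, e, eval_X, eval_X, hc, evalVec_smul]
      simp only [Pi.smul_apply, smul_eq_mul]
      ring
  have hψ0 := ψ.evalVec_zero hψ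
  have hφ0 := φ.evalVec_zero hφ
  have hUV : ∀ p ∈ planeCurve F ∩ {p | χ.evalVec p.rep ≠ 0},
      ∃ q ∈ φ.imageClosure (planeCurve F) ∩ {q | ω.evalVec q.rep ≠ 0},
        φ.HasValue p q ∧ ψ.HasValue q p := by
    rintro p ⟨hp, hpχ⟩
    rw [Set.mem_ofPred_eq, hχ] at hpχ
    have hw : φ.evalVec p.rep ≠ 0 := fun h0 => hpχ (by rw [h0, hψ0])
    obtain ⟨c, hc⟩ := hsmul p.rep p.rep_nonzero hp
    have hc0 : c ≠ 0 := by
      rintro rfl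
      exact hpχ (by rw [hc, zero_smul])
    refine ⟨_, ⟨φ.mk_evalVec_mem_imageClosure hp hw, ?_⟩, ⟨hw, rfl⟩, ?_⟩
    · apply ω.evalVec_rep_mk_ne_zero
      rw [hω, hc, evalVec_smul, evalVec_smul]
      exact smul_ne_zero (pow_ne_zero _ (pow_ne_zero _ hc0)) hpχ
    · have := ψ.hasValue_mk_of_eq_smul hw p.rep_nonzero hc0 hc
      rwa [Projectivization.mk_rep] at this
  have hVU : ∀ q ∈ φ.imageClosure (planeCurve F) ∩ {q | ω.evalVec q.rep ≠ 0},
      ∃ p ∈ planeCurve F ∩ {p | χ.evalVec p.rep ≠ 0}, ψ.HasValue q p ∧ φ.HasValue p q := by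
    rintro q ⟨hq, hqω⟩
    rw [Set.mem_ofPred_eq, hω] at hqω
    have hφv : φ.evalVec (ψ.evalVec q.rep) ≠ 0 := fun h0 => hqω (by rw [h0, hψ0])
    have hv : ψ.evalVec q.rep ≠ 0 := fun h0 => hφv (by rw [h0, hφ0])
    obtain ⟨c, hc⟩ := exists_eq_smul_of_mul_eq_mul q.rep_nonzero (hYφ hq)
    have hc0 : c ≠ 0 := by
      rintro rfl
      exact hφv (by rw [hc, zero_smul])
    refine ⟨_, ⟨(vanishesAt_mk hF hv).2 (hYF hq), ?_⟩, ⟨hv, rfl⟩, ?_⟩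
    · apply χ.evalVec_rep_mk_ne_zero
      rwa [hχ]
    · have := φ.hasValue_mk_of_eq_smul hv q.rep_nonzero hc0 hc
      rwa [Projectivization.mk_rep] at this
  have hUne : (planeCurve F ∩ {p | χ.evalVec p.rep ≠ 0}).Nonempty := by
    obtain ⟨v, hFv, hv⟩ := hne
    have hv0 : v ≠ 0 := by
      rintro rfl
      exact hv (by rw [hφ0, hψ0])
    exact ⟨Projectivization.mk ℂ v hv0, (vanishesAt_mk hF hv0).2 hFv,
      χ.evalVec_rep_mk_ne_zero hv0 (by rwa [hχ])⟩
  obtain ⟨p, hp⟩ := hUne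
  obtain ⟨q, hq, -⟩ := hUV p hp
  exact ⟨ψ, _, _, ⟨⟨p, hp⟩, _, χ.isZariskiOpen_evalVec_ne_zero, rfl⟩,
    ⟨⟨q, hq⟩, _, ω.isZariskiOpen_evalVec_ne_zero, rfl⟩, hUV, hVU⟩

/-! ### Passage to homogeneous components -/

/-- The restriction `t ↦ f(t w)` of the polynomial `f` to the line through the origin and `w`. -/
noncomputable def radialPoly (w : Fin 3 → ℂ) (f : MvPolynomial (Fin 3) ℂ) : Polynomial ℂ :=
  aeval ((Polynomial.X : Polynomial ℂ) • fun j => Polynomial.C (w j)) f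

theorem eval_radialPoly (w : Fin 3 → ℂ) (f : MvPolynomial (Fin 3) ℂ) (t : ℂ) :
    (radialPoly w f).eval t = eval (t • w) f := by
  rw [radialPoly, ← Polynomial.coe_aeval_eq_eval, ← AlgHom.restrictScalars_apply ℂ,
    map_aeval_comp, ← aeval_eq_eval]
  congr 2
  ext j
  simp only [Function.comp_apply, AlgHom.restrictScalars_apply, Polynomial.coe_aeval_eq_eval,
    Pi.smul_apply, smul_eq_mul, Polynomial.eval_mul, Polynomial.eval_X, Polynomial.eval_C]

theorem coeff_radialPoly (w : Fin 3 → ℂ) (f : MvPolynomial (Fin 3) ℂ) (e : ℕ) :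
    (radialPoly w f).coeff e = eval w (homogeneousComponent e f) := by
  have h (n : ℕ) : aeval ((Polynomial.X : Polynomial ℂ) • fun j => Polynomial.C (w j))
      (homogeneousComponent n f) =
      Polynomial.C (eval w (homogeneousComponent n f)) * Polynomial.X ^ n := by
    rw [aeval_smul_of_isHomogeneous (homogeneousComponent_isHomogeneous n f), mul_comm]
    congr 1
    have := map_aeval_comp (Polynomial.CAlgHom (R := ℂ) (A := ℂ)) (homogeneousComponent n f) w
    rw [aeval_eq_eval] at this
    exact this.symm
  rw [radialPoly]
  conv_lhs => rw [← sum_homogeneousComponent f, map_sum]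
  simp only [h, Polynomial.finsetSum_coeff, Polynomial.coeff_C_mul_X_pow]
  rw [Finset.sum_ite_eq]
  split_ifs with he
  · rfl
  · rw [homogeneousComponent_eq_zero _ _ (by simpa using he), map_zero]

/-- An inverse on `V(F)` that is given by polynomials which are not homogeneous can be replaced by
the homogeneous components of these polynomials in a suitable degree. -/
theorem ProjRatMap.isBirationalOntoImageOn_of_polynomial_leftInverse {F : MvPolynomial (Fin 3) ℂ}
    {d : ℕ} (hF : F.IsHomogeneous d) (φ : ProjRatMap) (hφ : 0 < φ.degree)
    (P : Fin 3 → MvPolynomial (Fin 3) ℂ)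
    (h : ∀ v, eval v F = 0 → ∀ i j,
      eval (φ.evalVec v) (P i) * v j = eval (φ.evalVec v) (P j) * v i)
    (hne : ∃ v, eval v F = 0 ∧ φ.evalVec v ≠ 0 ∧ ∃ k, eval (φ.evalVec v) (P k) ≠ 0) :
    φ.IsBirationalOntoImageOn (planeCurve F) := by
  have hcomp (v : Fin 3 → ℂ) (hv : eval v F = 0) (i j : Fin 3) (e : ℕ) :
      eval (φ.evalVec v) (homogeneousComponent e (P i)) * v j =
        eval (φ.evalVec v) (homogeneousComponent e (P j)) * v i := by
    set w := φ.evalVec v with hw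
    have hpoly : radialPoly w (P i) * Polynomial.C (v j) =
        radialPoly w (P j) * Polynomial.C (v i) := by
      refine Polynomial.eq_of_infinite_eval_eq _ _
        ((Set.finite_singleton (0 : ℂ)).infinite_compl.mono fun s hs => ?_)
      -- scaling `v` by `t` scales `φ v` by `t ^ φ.degree`, which takes every nonzero value
      obtain ⟨t, rfl⟩ := IsAlgClosed.exists_pow_nat_eq s hφ
      have ht : t ≠ 0 := by
        rintro rfl
        exact hs (zero_pow hφ.ne')
      have := h (t • v) (by rw [eval_smul_of_isHomogeneous hF, hv, mul_zero]) i j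
      rw [φ.evalVec_smul] at this
      simp only [Pi.smul_apply, smul_eq_mul] at this
      simp only [Set.mem_ofPred_eq, Polynomial.eval_mul, eval_radialPoly, Polynomial.eval_C]
      apply mul_left_cancel₀ ht
      linear_combination this
    have := congrArg (fun f => Polynomial.coeff f e) hpoly
    simpa [coeff_radialPoly] using this
  obtain ⟨v, hv, hφv, k, hk⟩ := hne
  obtain ⟨l, hl⟩ := Function.ne_iff.1 hφv
  obtain ⟨e, he⟩ : ∃ e, eval (φ.evalVec v) (homogeneousComponent e (P k)) ≠ 0 := by
    by_contra! hcon
    apply hk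
    rw [← sum_homogeneousComponent (P k), map_sum]
    exact Finset.sum_eq_zero fun e _ => hcon e
  -- the factor `X l` makes the degree positive
  let ψ : ProjRatMap :=
    { degree := 1 + e
      forms := fun i => X l * homogeneousComponent e (P i)
      homogeneous := fun i =>
        (isHomogeneous_X ℂ l).mul (homogeneousComponent_isHomogeneous e (P i)) }
  have hψ (w i) : ψ.evalVec w i = w l * eval w (homogeneousComponent e (P i)) := by
    simp [ψ, evalVec]
  refine φ.isBirationalOntoImageOn_of_leftInverse hF ψ hφ (by simp [ψ]) (fun v hv i j => ?_)
    ⟨v, hv, Function.ne_iff.2 ⟨k, ?_⟩⟩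
  · rw [hψ, hψ, mul_assoc, mul_assoc, hcomp v hv]
  · rw [hψ]
    exact mul_ne_zero hl he

/-! ### Specialization of a generic source -/

/-- The generic point of the curve `V(F)`, with coordinates in the field of fractions of
`ℂ[x, y, z] / (F)`. -/
theorem exists_generic_point {F : MvPolynomial (Fin 3) ℂ} (hirr : Irreducible F) :
    ∃ (K : Type) (_ : Field K) (_ : Algebra ℂ K) (x : Fin 3 → K),
      ∀ G, aeval x G = 0 ↔ F ∣ G := by
  have hp : (Ideal.span {F}).IsPrime :=
    (Ideal.span_singleton_prime hirr.ne_zero).2 hirr.prime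
  let R := MvPolynomial (Fin 3) ℂ ⧸ Ideal.span {F}
  let f : MvPolynomial (Fin 3) ℂ →ₐ[ℂ] FractionRing R :=
    (IsScalarTower.toAlgHom ℂ R (FractionRing R)).comp (Ideal.Quotient.mkₐ ℂ (Ideal.span {F}))
  refine ⟨FractionRing R, inferInstance, inferInstance, fun i => f (X i), fun G => ?_⟩
  have hf : aeval (fun i => f (X i)) G = f G :=
    congrArg (· G) (aeval_unique f).symm
  rw [hf]
  change algebraMap R (FractionRing R) (Ideal.Quotient.mk _ G) = 0 ↔ _
  rw [FaithfulSMul.algebraMap_eq_zero_iff, Ideal.Quotient.eq_zero_iff_mem,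
    Ideal.mem_span_singleton]

theorem exists_algebraicIndependent (K : Type) [Field K] [Algebra ℂ K] :
    ∃ (Ω : Type) (_ : Field Ω) (_ : Algebra K Ω) (_ : Algebra ℂ Ω) (_ : IsScalarTower ℂ K Ω)
      (_ : IsAlgClosed Ω) (a : Fin 3 → Ω), AlgebraicIndependent K a := by
  let R := MvPolynomial (Fin 3) K
  let Ω := AlgebraicClosure (FractionRing R)
  refine ⟨Ω, inferInstance, inferInstance, inferInstance, inferInstance, inferInstance,
    fun i => algebraMap R Ω (X i), ?_⟩
  have h := (algebraicIndependent_X (Fin 3) K).map' (f := IsScalarTower.toAlgHom K R Ω)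
    (by
      rw [IsScalarTower.coe_toAlgHom', IsScalarTower.algebraMap_eq R (FractionRing R) Ω]
      exact (algebraMap (FractionRing R) Ω).injective.comp (IsFractionRing.injective R _))
  exact h

/-- Polynomials in the source (left variables) and the point of incidence (right variables) can be
evaluated by substituting the point into the coefficients first, and the source afterwards. -/
theorem aeval_sumElim_eq_aeval_map {K B : Type*} [Field K] [CommRing B] [Algebra ℂ K] [Algebra K B]
    [Algebra ℂ B] [IsScalarTower ℂ K B] (b : Fin 3 → B) (y : Fin 3 → K)
    (H : MvPolynomial (Fin 3 ⊕ Fin 3) ℂ) :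
    aeval (Sum.elim b (algebraMap K B ∘ y)) H =
      aeval b (map (aeval y : MvPolynomial (Fin 3) ℂ →ₐ[ℂ] K).toRingHom
        (sumAlgEquiv ℂ (Fin 3) (Fin 3) H)) := by
  let e : MvPolynomial (Fin 3 ⊕ Fin 3) ℂ →ₐ[ℂ] B :=
    ((aeval b).restrictScalars ℂ).comp ((mapAlgHom (aeval y : MvPolynomial (Fin 3) ℂ →ₐ[ℂ] K)).comp
      (sumAlgEquiv ℂ (Fin 3) (Fin 3)).toAlgHom)
  have : aeval (Sum.elim b (algebraMap K B ∘ y)) = e := by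
    ext i
    rcases i with i | i <;> simp [e]
  rw [this]
  rfl

section GenericSource

variable {K Ω : Type} [Field K] [Field Ω] [Algebra ℂ K] [Algebra K Ω] [Algebra ℂ Ω]
  [IsScalarTower ℂ K Ω] {F : MvPolynomial (Fin 3) ℂ} {x : Fin 3 → K} {a : Fin 3 → Ω}

/-- An algebraic relation between a generic source and the generic point of the curve holds for all
sources and all points of the curve. -/
theorem aeval_sumElim_eq_zero_of_generic (hx : ∀ G, aeval x G = 0 ↔ F ∣ G)
    (ha : AlgebraicIndependent K a) {H : MvPolynomial (Fin 3 ⊕ Fin 3) ℂ}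
    (hH : aeval (Sum.elim a (algebraMap K Ω ∘ x)) H = 0) (s v : Fin 3 → ℂ) (hv : eval v F = 0) :
    aeval (Sum.elim s v) H = 0 := by
  rw [aeval_sumElim_eq_aeval_map] at hH
  have h0 := (injective_iff_map_eq_zero _).1 ha _ hH
  have h1 := aeval_sumElim_eq_aeval_map s v H
  rw [show algebraMap ℂ ℂ ∘ v = v from rfl] at h1
  rw [h1]
  convert map_zero (aeval s)
  ext n
  have hn := congrArg (coeff n) h0
  rw [coeff_map, coeff_zero] at hn ⊢
  obtain ⟨Q, hQ⟩ := (hx _).1 hn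
  rw [hQ, map_mul]
  refine mul_eq_zero_of_left ?_ _
  simpa [aeval_eq_eval] using hv

/-- If an expression in a generic source and the generic point of the curve is not zero, then there
is a point of the curve at which it is a nonzero polynomial in the source. -/
theorem exists_eval_eq_aeval_sumElim_of_generic (hirr : Irreducible F)
    (hx : ∀ G, aeval x G = 0 ↔ F ∣ G) {H : MvPolynomial (Fin 3 ⊕ Fin 3) ℂ}
    (hH : aeval (Sum.elim a (algebraMap K Ω ∘ x)) H ≠ 0) :
    ∃ p : MvPolynomial (Fin 3) ℂ, p ≠ 0 ∧ ∃ v, eval v F = 0 ∧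
      ∀ s, aeval (Sum.elim s v) H = eval s p := by
  rw [aeval_sumElim_eq_aeval_map] at hH
  have hH' : map (aeval x : MvPolynomial (Fin 3) ℂ →ₐ[ℂ] K).toRingHom
      (sumAlgEquiv ℂ (Fin 3) (Fin 3) H) ≠ 0 := fun h => hH (by rw [h, map_zero])
  obtain ⟨n, hn⟩ := ne_zero_iff.1 hH'
  rw [coeff_map] at hn
  obtain ⟨v, hv, hvn⟩ : ∃ v, eval v F = 0 ∧
      eval v (coeff n (sumAlgEquiv ℂ (Fin 3) (Fin 3) H)) ≠ 0 := by
    by_contra! hcon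
    exact hn ((hx _).2 (dvd_of_forall_eval_eq_zero hirr hcon))
  refine ⟨map (aeval v : MvPolynomial (Fin 3) ℂ →ₐ[ℂ] ℂ).toRingHom
    (sumAlgEquiv ℂ (Fin 3) (Fin 3) H), ne_zero_iff.2 ⟨n, ?_⟩, v, hv, fun s => ?_⟩
  · rw [coeff_map]
    simpa [aeval_eq_eval] using hvn
  · rw [← aeval_eq_eval]
    exact aeval_sumElim_eq_aeval_map s v H

/-- The reflected line, as a polynomial expression in the source (left variables) and the point
of incidence (right variables). -/
noncomputable def genericReflVec (F : MvPolynomial (Fin 3) ℂ) :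
    Fin 3 → MvPolynomial (Fin 3 ⊕ Fin 3) ℂ :=
  reflVec (fun i => X (Sum.inr i)) (gradVec F fun i => X (Sum.inr i)) fun i => X (Sum.inl i)

theorem aeval_genericReflVec {B : Type*} [CommRing B] [Algebra ℂ B] (b y : Fin 3 → B) (j : Fin 3) :
    aeval (Sum.elim b y) (genericReflVec F j) = reflVec y (gradVec F y) b j := by
  have h := map_reflVec (aeval (R := ℂ) (Sum.elim b y)).toRingHom (fun i => X (Sum.inr i))
    (gradVec F fun i => X (Sum.inr i)) (fun i => X (Sum.inl i)) j
  have hg := map_gradVec (aeval (R := ℂ) (Sum.elim b y)) F (fun i => X (Sum.inr i))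
  have hy : ⇑(aeval (R := ℂ) (Sum.elim b y)) ∘ (fun i => X (Sum.inr i)) = y := by ext; simp
  have hb : ⇑(aeval (R := ℂ) (Sum.elim b y)) ∘ (fun i => X (Sum.inl i)) = b := by ext; simp
  rw [hy] at hg
  refine h.trans ?_
  change reflVec (⇑(aeval (R := ℂ) (Sum.elim b y)) ∘ _) (⇑(aeval (R := ℂ) (Sum.elim b y)) ∘ _)
    (⇑(aeval (R := ℂ) (Sum.elim b y)) ∘ _) j = _
  rw [hy, hg, hb]

end GenericSource

/-- There are a nonzero polynomial `p` and polynomials `P i` in the coordinates of the source and of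
the reflected line such that, for every source `s`, the `P i` give the coordinates of the point of
incidence, and do so without vanishing identically if `p` does not vanish at `s`. -/
theorem exists_polynomial_inverse {F : MvPolynomial (Fin 3) ℂ} {d : ℕ} (hd : 2 ≤ d)
    (hF : F.IsHomogeneous d) (hirr : Irreducible F) :
    ∃ P : Fin 3 → MvPolynomial (Fin 3 ⊕ Fin 3) ℂ,
      (∀ s v, eval v F = 0 → ∀ i j,
        aeval (Sum.elim s (reflVec v (gradVec F v) s)) (P i) * v j =
          aeval (Sum.elim s (reflVec v (gradVec F v) s)) (P j) * v i) ∧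
      ∃ p : MvPolynomial (Fin 3) ℂ, p ≠ 0 ∧ ∃ v, eval v F = 0 ∧ ∀ s, eval s p ≠ 0 →
        reflVec v (gradVec F v) s ≠ 0 ∧
          aeval (Sum.elim s (reflVec v (gradVec F v) s)) (P 2) ≠ 0 := by
  obtain ⟨K, _, _, x, hx⟩ := exists_generic_point hirr
  obtain ⟨Ω, _, _, _, _, _, a, ha⟩ := exists_algebraicIndependent K
  have hxF : aeval x F = 0 := (hx F).2 dvd_rfl
  have hxQ : aeval x (gradQ F) ≠ 0 := fun h => not_dvd_gradQ hd hF hirr ((hx _).1 h)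
  have hxi (i : Fin 3) : x i ≠ 0 := fun h =>
    not_dvd_X hd hF i ((hx _).1 (by rw [aeval_X, h]))
  set m := algebraMap K Ω ∘ x with hm
  set T := reflVec m (gradVec F m) a with hT
  have hmi (i : Fin 3) : m i ≠ 0 := by simpa [hm] using hxi i
  have hmem := div_mem_adjoin_reflVec hF hirr.ne_zero hxF hxQ (hxi 2) ha
  rw [← hm, ← hT] at hmem
  simp only [IntermediateField.mem_adjoin_range_iff] at hmem
  choose r q hrq using hmem
  have hq (i : Fin 3) : aeval (Sum.elim a T) (q i) ≠ 0 := fun h => by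
    have := hrq i
    rw [h, div_zero, map_eq_zero] at this
    exact div_ne_zero (hxi i) (hxi 2) this
  let P : Fin 3 → MvPolynomial (Fin 3 ⊕ Fin 3) ℂ :=
    ![r 0 * q 1 * q 2, r 1 * q 0 * q 2, r 2 * q 0 * q 1]
  set c := aeval (Sum.elim a T) (q 0 * q 1 * q 2) / m 2 with hc
  have hP (i : Fin 3) : aeval (Sum.elim a T) (P i) = c * m i := by
    have h0 (i : Fin 3) : aeval (Sum.elim a T) (r i) = m i / m 2 * aeval (Sum.elim a T) (q i) := by
      rw [← div_eq_iff (hq i), ← hrq i, map_div₀]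
      rfl
    have := hmi 2
    fin_cases i <;> simp [P, hc, h0] <;> field_simp
  have hc0 : c ≠ 0 := div_ne_zero (by simp [hq]) (hmi 2)
  -- `Ψ` substitutes the reflected line for the right variables
  let Ψ := aeval (R := ℂ) (Sum.elim (fun i => X (Sum.inl i)) (genericReflVec F))
  have hΨ {B : Type} [CommRing B] [Algebra ℂ B] (b y : Fin 3 → B)
      (H : MvPolynomial (Fin 3 ⊕ Fin 3) ℂ) : aeval (Sum.elim b y) (Ψ H) =
        aeval (Sum.elim b (reflVec y (gradVec F y) b)) H := by
    simp only [Ψ]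
    rw [← AlgHom.comp_apply, comp_aeval]
    congr 2
    ext i
    rcases i with i | i
    · simp
    · simp [aeval_genericReflVec]
  refine ⟨P, fun s v hv i j => ?_, ?_⟩
  · have := aeval_sumElim_eq_zero_of_generic hx ha
      (H := Ψ (P i) * X (Sum.inr j) - Ψ (P j) * X (Sum.inr i)) ?_ s v hv
    · rw [map_sub, map_mul, map_mul, hΨ, hΨ, aeval_X, aeval_X, Sum.elim_inr, Sum.elim_inr] at this
      exact sub_eq_zero.1 this
    · rw [map_sub, map_mul, map_mul, hΨ, hΨ, ← hm, ← hT, hP, hP]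
      simp
      ring
  · obtain ⟨l, hl⟩ : ∃ l, T l ≠ 0 := by
      have hma : m ⨯₃ a ≠ 0 := by
        intro h
        have h2 : m 0 * a 1 - m 1 * a 0 = 0 := by simpa [cross_apply] using congrFun h 2
        have := ha.linear_coeff_eq_zero (c := ![-x 1, x 0, 0])
          (by simp [Fin.sum_univ_three]; simp [hm] at h2; linear_combination h2) 1
        exact hxi 0 this
      have hmF : aeval m F = 0 := by
        have := map_aeval_comp (IsScalarTower.toAlgHom ℂ K Ω) F x
        rw [hxF, map_zero] at this
        exact this.symm
      have hmQ : gradVec F m 0 ^ 2 + gradVec F m 1 ^ 2 ≠ 0 := by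
        have h := map_aeval_comp (IsScalarTower.toAlgHom ℂ K Ω) (gradQ F) x
        have h0 : aeval m (gradQ F) ≠ 0 := fun h' =>
          hxQ ((map_eq_zero (algebraMap K Ω)).1 (h.trans h'))
        simpa [gradQ, gradVec] using h0
      exact Function.ne_iff.1 (reflVec_ne_zero (gradVec_dotProduct_self hF hmF) hmQ hma)
    obtain ⟨p, hp0, v, hv, hp⟩ := exists_eval_eq_aeval_sumElim_of_generic (a := a) hirr hx
      (H := genericReflVec F l * Ψ (P 2)) (by
        rw [map_mul, aeval_genericReflVec, hΨ, ← hm, ← hT, hP]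
        exact mul_ne_zero hl (mul_ne_zero hc0 (hmi 2)))
    refine ⟨p, hp0, v, hv, fun s hs => ?_⟩
    rw [← hp, map_mul, aeval_genericReflVec, hΨ] at hs
    exact ⟨Function.ne_iff.2 ⟨l, left_ne_zero_of_mul hs⟩, right_ne_zero_of_mul hs⟩

/-! ### Birationality of the reflected map -/

theorem mainTheorem3 (d : ℕ) (hd : 2 ≤ d) (F : MvPolynomial (Fin 3) ℂ)
    (hF : F.IsHomogeneous d) (hirr : Irreducible F) :
    ∃ U : Set ProjPlane, IsZariskiOpen U ∧ U.Nonempty ∧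
      ∀ S ∈ U, (reflectedMap hF S).IsBirationalOntoImageOn (planeCurve F) := by
  obtain ⟨P, hP, p, hp0, v, hv, hpv⟩ := exists_polynomial_inverse hd hF hirr
  refine ⟨{S | ∃ e, eval S.rep (homogeneousComponent e p) ≠ 0},
    ⟨Set.range fun e => homogeneousComponent e p, ?_, ?_⟩, ?_, fun S hS => ?_⟩
  -- `p` need not be homogeneous: the open set consists of the points where some component of `p`
  -- does not vanish
  · rintro _ ⟨e, rfl⟩
    exact ⟨e, homogeneousComponent_isHomogeneous e p⟩
  · ext S
    simp [VanishesAt]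
  · -- the factor `X 0` ensures that `s` is not the zero vector
    obtain ⟨s, hs⟩ : ∃ s, eval s (X 0 * p) ≠ 0 := by
      by_contra! hcon
      exact mul_ne_zero (X_ne_zero 0) hp0 (MvPolynomial.funext fun s => by rw [hcon, map_zero])
    rw [map_mul, eval_X] at hs
    have hs0 : s ≠ 0 := fun h => left_ne_zero_of_mul hs (by rw [h]; rfl)
    refine ⟨Projectivization.mk ℂ s hs0, ?_⟩
    by_contra hcon
    simp only [Set.mem_ofPred_eq, not_exists, not_not] at hcon
    apply right_ne_zero_of_mul hs
    rw [← sum_homogeneousComponent p, map_sum]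
    exact Finset.sum_eq_zero fun e _ =>
      (vanishesAt_mk (homogeneousComponent_isHomogeneous e p) hs0).1 (hcon e)
  · obtain ⟨e, he⟩ := hS
    -- some multiple `s` of the representative of `S` is not a zero of `p`
    obtain ⟨t, ht⟩ : ∃ t, eval (t • S.rep) p ≠ 0 := by
      by_contra! hcon
      have h0 : radialPoly S.rep p = 0 :=
        Polynomial.funext fun t => by rw [eval_radialPoly, hcon, Polynomial.eval_zero]
      exact he (by rw [← coeff_radialPoly, h0, Polynomial.coeff_zero])
    have hφ (w : Fin 3 → ℂ) :
        (reflectedMap hF S).evalVec w = reflVec w (gradVec F w) S.rep := by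
      ext j
      change eval w (reflectedForms F S.rep j) = _
      exact eval_reflectedForms F S.rep w j
    let Q (i : Fin 3) : MvPolynomial (Fin 3) ℂ :=
      aeval (Sum.elim (fun j => C ((t • S.rep) j)) (fun j => C t * X j)) (P i)
    have hQ (w : Fin 3 → ℂ) (i : Fin 3) : eval ((reflectedMap hF S).evalVec w) (Q i) =
        aeval (Sum.elim (t • S.rep) (reflVec w (gradVec F w) (t • S.rep))) (P i) := by
      rw [reflVec_smul_source, ← hφ, ← aeval_eq_eval, ← AlgHom.comp_apply, comp_aeval]
      congr 2
      ext k
      rcases k with k | k <;> simp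
    refine ProjRatMap.isBirationalOntoImageOn_of_polynomial_leftInverse hF _
      (by simp [reflectedMap]) Q (fun w hw i j => ?_) ⟨v, hv, ?_, 2, ?_⟩
    · rw [hQ, hQ]
      exact hP _ w hw i j
    · have := (hpv _ ht).1
      rw [reflVec_smul_source, ← hφ] at this
      exact right_ne_zero_of_smul this
    · rw [hQ]
      exact (hpv _ ht).2
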